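/- Let $E\subset\mathbb{R}^d$ be an arbitrary set, let $\phi$ be a random vector in $\mathbb{R}^d$, and let $\phi_1,\dots,\phi_m$ be independent copies of $\phi$. For $\xi\ge 0$ define the marginal tail function $$Q_\xi(E;\phi):=\inf_{u\in E}\ \mathbb{P}\{|\langle u,\phi\rangle|\ge\xi\}.$$ Let $\varepsilon_1,\dots,\varepsilon_m$ be independent Rademacher random variables (taking the values $\pm1$ with probability $1/2$ each), independent of $(\phi_1,\dots,\phi_m)$, and define the mean empirical width $$W_m(E;\phi):=\mathbb{E}\,\sup_{u\in E}\langle u,h\rangle,\qquad h:=\frac1{\sqrt m}\sum_{i=1}^m\varepsilon_i\phi_i,$$ where it is assumed that this expectation exists in $[-\infty,\infty]$ (the positive and the negative part of the supremum do not both have infinite expectation). Then, for all $\xi>0$ and $t>0$, with probability at least $1-e^{-t^2/2}$, $$\inf_{u\in E}\Big(\sum_{i=1}^m|\langle u,\phi_i\rangle|^2\Big)^{1/2}\ \ge\ \xi\sqrt m\,Q_{2\xi}(E;\phi)-2W_m(E;\phi)-\xi t,$$ as an inequality between extended real numbers, which is trivially true when $W_m(E;\phi)=+\infty$ or when $E=\emptyset$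 (in the latter case the infimum on the left is $+\infty$). -/

import Mathlib

open MeasureTheory ProbabilityTheory
open scoped ENNReal

noncomputable section

namespace SmallBall

/-- The expectation of an extended-real random variable, `E X = E X⁺ - E X⁻`.
It is meaningful when `ExpectationExists P X` holds. -/
def expectation {Ω : Type*} [MeasurableSpace Ω] (P : Measure Ω) (X : Ω → EReal) : EReal :=
  ((∫⁻ ω, (X ω).toENNReal ∂P : ℝ≥0∞) : EReal) - ((∫⁻ ω, (-X ω).toENNReal ∂P : ℝ≥0∞) : EReal)

/-- The expectation of `X` exists in `[-∞, ∞]`: `E X⁺` and `E X⁻` are not both infinite. -/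
def ExpectationExists {Ω : Type*} [MeasurableSpace Ω] (P : Measure Ω) (X : Ω → EReal) : Prop :=
  (∫⁻ ω, (X ω).toENNReal ∂P) ≠ ∞ ∨ (∫⁻ ω, (-X ω).toENNReal ∂P) ≠ ∞

/-- A Rademacher random variable takes the two values `1` and `-1` with equal probability. -/
structure IsRademacher {Ω : Type*} [MeasurableSpace Ω] (P : Measure Ω) (ε : Ω → ℝ) : Prop where
  aemeasurable : AEMeasurable ε P
  prob_one : P {ω | ε ω = 1} = 1 / 2
  prob_neg_one : P {ω | ε ω = -1} = 1 / 2

/-- The marginal tail function `Q_ξ(E; φ) = inf_{u ∈ E} P {|⟨u, φ⟩| ≥ ξ}`. -/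
def marginalTail {Ω : Type*} [MeasurableSpace Ω] (P : Measure Ω) {d : ℕ}
    (φ : Ω → EuclideanSpace ℝ (Fin d)) (E : Set (EuclideanSpace ℝ (Fin d))) (ξ : ℝ) : ℝ≥0∞ :=
  ⨅ u ∈ E, P {ω | ξ ≤ |inner ℝ u (φ ω)|}

/-- The random vector `h = m^{-1/2} ∑ᵢ εᵢ φᵢ`. -/
def signedSum {Ω : Type*} {m d : ℕ} (φs : Fin m → Ω → EuclideanSpace ℝ (Fin d))
    (ε : Fin m → Ω → ℝ) (ω : Ω) : EuclideanSpace ℝ (Fin d) :=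
  (1 / √(m : ℝ)) • ∑ i, ε i ω • φs i ω

/-- The random variable `sup_{u ∈ E} ⟨u, h⟩`, with values in `[-∞, ∞]`. -/
def supWidth {Ω : Type*} {m d : ℕ} (φs : Fin m → Ω → EuclideanSpace ℝ (Fin d))
    (ε : Fin m → Ω → ℝ) (E : Set (EuclideanSpace ℝ (Fin d))) (ω : Ω) : EReal :=
  ⨆ u ∈ E, ((inner ℝ u (signedSum φs ε ω) : ℝ) : EReal)

/-- The mean empirical width `W_m(E; φ) = E sup_{u ∈ E} ⟨u, h⟩`. -/
def meanEmpiricalWidth {Ω : Type*} [MeasurableSpace Ω] (P : Measure Ω) {m d : ℕ}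
    (φs : Fin m → Ω → EuclideanSpace ℝ (Fin d)) (ε : Fin m → Ω → ℝ)
    (E : Set (EuclideanSpace ℝ (Fin d))) : EReal :=
  expectation P (supWidth φs ε E)

/-- The infimum of the empirical process, `inf_{u ∈ E} (∑ᵢ |⟨u, φᵢ⟩|²)^{1/2}`. -/
def infProcess {Ω : Type*} {m d : ℕ} (φs : Fin m → Ω → EuclideanSpace ℝ (Fin d))
    (E : Set (EuclideanSpace ℝ (Fin d))) (ω : Ω) : EReal :=
  ⨅ u ∈ E, ((√(∑ i, |inner ℝ u (φs i ω)| ^ 2) : ℝ) : EReal)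

end SmallBall

end

/-! Write ψ for `softThreshold ξ`: it is 1-Lipschitz, takes values in [0, ξ], lies below |s|, and
equals ξ once |s| ≥ 2ξ. By Cauchy–Schwarz, √m times the process at u is at least ∑ |⟨u, φᵢ⟩| ≥ ∑
ψ(⟨u, φᵢ⟩), and Markov's inequality gives E ψ(⟨u, φ⟩) ≥ ξ Q_{2ξ}. Hence √m times the process is at
least m ξ Q_{2ξ} - D for every u, where D = sup_u ∑ (E ψ(⟨u, φ⟩) - ψ(⟨u, φᵢ⟩)) is `supDeviation`.

Replacing one sample point moves D by at most ξ, so `measure_le_of_bounded_differences` gives D ≤ E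
D + ξ t √m with the required probability. By `symmetrization` and then `sum_iSup_contraction`, E D
is at most 2 E sup_u ∑ εᵢ⟨u, φᵢ⟩ = 2 √m W_m. Dividing by √m gives the claim.

Since E is arbitrary, suprema are first reduced to a dense sequence. The extended-real width is then
either +∞, where the bound is trivial, or an average of real integrals over the 2^m sign patterns
(`expectation_iSup_signedInner`). Symmetrization and contraction are therefore phrased as finite
sums over patterns. -/

namespace SmallBall

/-- The sign encoded by a Boolean: `true ↦ 1`, `false ↦ -1`. -/
def boolSign (b : Bool) : ℝ := if b then 1 else -1

@[simp] lemma boolSign_true : boolSign true = 1 := rfl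

@[simp] lemma boolSign_false : boolSign false = -1 := rfl

@[simp] lemma boolSign_not (b : Bool) : boolSign (!b) = -boolSign b := by cases b <;> simp

lemma abs_boolSign (b : Bool) : |boolSign b| = 1 := by cases b <;> simp

/-! ### Contraction for averages over sign patterns -/

section Contraction

variable {ι : Type*} {ψ : ℝ → ℝ}

/-- The case of a single sign. For competitors u and w on the left, the ψ-terms contribute at most
|a u - a w|; according to the sign of a u - a w, the pair (u, w) or (w, u) attains this on the
right. -/
lemma iSup_add_iSup_contraction [Nonempty ι] (hψ : ∀ x y, |ψ x - ψ y| ≤ |x - y|) (a c : ι → ℝ)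
    (h₁ : BddAbove (Set.range fun u => c u + a u))
    (h₂ : BddAbove (Set.range fun u => c u - a u)) :
    (⨆ u, (c u + ψ (a u))) + ⨆ u, (c u - ψ (a u)) ≤ (⨆ u, (c u + a u)) + ⨆ u, (c u - a u) := by
  rw [← le_sub_iff_add_le]
  refine ciSup_le fun u => ?_
  rw [le_sub_iff_add_le, add_comm, ← le_sub_iff_add_le]
  refine ciSup_le fun w => ?_
  have hd := hψ (a u) (a w)
  have hle := le_abs_self (ψ (a u) - ψ (a w))
  have h1u : c u + a u ≤ ⨆ u, (c u + a u) := le_ciSup h₁ u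
  have h1w : c w + a w ≤ ⨆ u, (c u + a u) := le_ciSup h₁ w
  have h2u : c u - a u ≤ ⨆ u, (c u - a u) := le_ciSup h₂ u
  have h2w : c w - a w ≤ ⨆ u, (c u - a u) := le_ciSup h₂ w
  rcases abs_cases (a u - a w) with h | h <;> linarith

/-- Real suprema of unbounded families are 0 by convention, so boundedness has to be carried along.
The two hypotheses bound c + |a|, and ψ grows at most like |a| + |ψ 0|. -/
lemma bddAbove_add_contraction (hψ : ∀ x y, |ψ x - ψ y| ≤ |x - y|) {a c : ι → ℝ}
    (h₁ : BddAbove (Set.range fun u => c u + a u))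
    (h₂ : BddAbove (Set.range fun u => c u - a u)) (b : Bool) :
    BddAbove (Set.range fun u => c u + boolSign b * ψ (a u)) := by
  obtain ⟨A, hA⟩ := h₁
  obtain ⟨B, hB⟩ := h₂
  refine ⟨max A B + |ψ 0|, ?_⟩
  rintro _ ⟨u, rfl⟩
  have h1 : c u + a u ≤ A := hA ⟨u, rfl⟩
  have h2 : c u - a u ≤ B := hB ⟨u, rfl⟩
  have h3 : boolSign b * ψ (a u) ≤ |a u| + |ψ 0| := by
    calc boolSign b * ψ (a u) ≤ |boolSign b * ψ (a u)| := le_abs_self _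
      _ = |ψ (a u)| := by rw [abs_mul, abs_boolSign, one_mul]
      _ = |(ψ (a u) - ψ 0) + ψ 0| := by ring_nf
      _ ≤ |ψ (a u) - ψ 0| + |ψ 0| := abs_add_le _ _
      _ ≤ |a u| + |ψ 0| := by simpa using hψ (a u) 0
  have h4 := le_max_left A B
  have h5 := le_max_right A B
  change c u + boolSign b * ψ (a u) ≤ _
  rcases abs_cases (a u) with h | h <;> linarith

/-- The **contraction principle** for Rademacher averages. -/
theorem sum_iSup_contraction [Nonempty ι]
    (hψ : ∀ x y, |ψ x - ψ y| ≤ |x - y|) {m : ℕ} (a : Fin m → ι → ℝ)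
    (b : ι → ℝ)
    (hb : ∀ s : Fin m → Bool, BddAbove (Set.range fun u => b u + ∑ i, boolSign (s i) * a i u)) :
    ∑ s : Fin m → Bool, ⨆ u, (b u + ∑ i, boolSign (s i) * ψ (a i u)) ≤
      ∑ s : Fin m → Bool, ⨆ u, (b u + ∑ i, boolSign (s i) * a i u) := by
  -- With the first sign fixed, its ψ-term is absorbed into `b` and the induction hypothesis
  -- contracts the other coordinates; the one-sign lemma then contracts the first. No condition ψ 0
  -- = 0 is needed, as the suprema carry no absolute values.
  induction m generalizing b with
  | zero => simp
  | succ m ih =>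
    have hb' : ∀ (s₀ : Bool) (s : Fin m → Bool), BddAbove (Set.range fun u =>
        (b u + ∑ i, boolSign (s i) * a i.succ u) + boolSign s₀ * a 0 u) := by
      intro s₀ s
      have := hb (Fin.cons s₀ s)
      simp only [Fin.sum_univ_succ, Fin.cons_zero, Fin.cons_succ] at this
      convert this using 3
      ring
    have h₁ : ∀ s : Fin m → Bool, BddAbove (Set.range fun u =>
        (b u + ∑ i, boolSign (s i) * a i.succ u) + a 0 u) := fun s => by simpa using hb' true s
    have h₂ : ∀ s : Fin m → Bool, BddAbove (Set.range fun u =>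
        (b u + ∑ i, boolSign (s i) * a i.succ u) - a 0 u) := fun s => by
      simpa [sub_eq_add_neg] using hb' false s
    have split : ∀ F : (Fin (m + 1) → Bool) → ℝ,
        ∑ s, F s = (∑ s : Fin m → Bool, F (Fin.cons true s)) +
          ∑ s : Fin m → Bool, F (Fin.cons false s) := by
      intro F
      rw [← (Fin.consEquiv fun _ : Fin (m + 1) => Bool).sum_comp, Fintype.sum_prod_type,
        Fintype.sum_bool]
      rfl
    have step : ∀ s₀ : Bool,
        ∑ s : Fin m → Bool, ⨆ u, (b u + (boolSign s₀ * ψ (a 0 u) +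
          ∑ i : Fin m, boolSign (s i) * ψ (a i.succ u))) ≤
        ∑ s : Fin m → Bool, ⨆ u, ((b u + ∑ i : Fin m, boolSign (s i) * a i.succ u) +
          boolSign s₀ * ψ (a 0 u)) := by
      intro s₀
      have := ih (fun i => a i.succ) (fun u => b u + boolSign s₀ * ψ (a 0 u)) fun s => by
        convert bddAbove_add_contraction hψ (h₁ s) (h₂ s) s₀ using 3
        ring
      refine (Finset.sum_congr rfl fun s _ => iSup_congr fun u => ?_).trans_le
        (this.trans_eq (Finset.sum_congr rfl fun s _ => iSup_congr fun u => ?_)) <;> ring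
    rw [split, split]
    simp only [Fin.sum_univ_succ, Fin.cons_zero, Fin.cons_succ]
    refine (add_le_add (step true) (step false)).trans ?_
    rw [← Finset.sum_add_distrib, ← Finset.sum_add_distrib]
    refine Finset.sum_le_sum fun s _ => ?_
    have := iSup_add_iSup_contraction hψ _ _ (h₁ s) (h₂ s)
    refine (congrArg₂ (· + ·) (iSup_congr fun u => ?_) (iSup_congr fun u => ?_)).trans_le
      (this.trans_eq (congrArg₂ (· + ·) (iSup_congr fun u => ?_) (iSup_congr fun u => ?_))) <;>
    · simp only [boolSign_true, boolSign_false]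
      ring

end Contraction

/-! ### Concentration under bounded differences -/

section BoundedDifferences

variable {V : Type*} [MeasurableSpace V]

lemma integrable_of_abs_le {α : Type*} [MeasurableSpace α] {μ : Measure α} [IsFiniteMeasure μ]
    {f : α → ℝ} (hf : Measurable f) {C : ℝ} (hC : ∀ x, |f x| ≤ C) : Integrable f μ :=
  .of_bound hf.aestronglyMeasurable C (.of_forall hC)

/-- Exponential moments of a bounded variable whose oscillation is at most `c`. -/
lemma integral_exp_le_of_oscillation (μ : Measure V) [IsProbabilityMeasure μ] {g : V → ℝ}
    (hg : Measurable g) {c : ℝ} (hosc : ∀ y z, |g y - g z| ≤ c) (r : ℝ) :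
    ∫ y, Real.exp (r * g y) ∂μ ≤ Real.exp (r * ∫ y, g y ∂μ + c ^ 2 * r ^ 2 / 2) := by
  obtain ⟨z⟩ : Nonempty V := nonempty_of_isProbabilityMeasure μ
  have hc : 0 ≤ c := (abs_nonneg _).trans (hosc z z)
  -- Hoeffding's lemma on an interval of length 2c centred at one value of g. The resulting variance
  -- proxy c² is not optimal, but it gives exactly the exponent t²/2 needed later.
  have h := (hasSubgaussianMGF_of_mem_Icc (μ := μ) (a := g z - c) (b := g z + c)
    hg.aemeasurable (.of_forall fun y => by
      have := abs_le.1 (hosc y z)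
      constructor <;> linarith)).mgf_le r
  have e : (((‖g z + c - (g z - c)‖₊ / 2) ^ 2 : NNReal) : ℝ) = c ^ 2 := by
    have : g z + c - (g z - c) = 2 * c := by ring
    rw [this]
    push_cast
    rw [Real.norm_of_nonneg (by positivity)]
    ring
  rw [e] at h
  simp only [mgf, mul_sub, Real.exp_sub] at h
  rw [integral_div, div_le_iff₀ (Real.exp_pos _), ← Real.exp_add, add_comm] at h
  exact h

/-- Exponential moments of a bounded function of independent variables with bounded
differences. -/
theorem integral_exp_le_of_bounded_differences (μ : Measure V) [IsProbabilityMeasure μ]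
    {c : ℝ} (r : ℝ) {m : ℕ} (f : (Fin m → V) → ℝ) (hf : Measurable f)
    {C : ℝ} (hC : ∀ x, |f x| ≤ C)
    (hd : ∀ x i y, |f (Function.update x i y) - f x| ≤ c) :
    ∫ x, Real.exp (r * f x) ∂(Measure.pi fun _ => μ) ≤
      Real.exp (r * (∫ x, f x ∂(Measure.pi fun _ => μ)) + m * (c ^ 2 * r ^ 2 / 2)) := by
  induction m with
  | zero =>
    have : f = fun _ => f default := funext fun x => congrArg f (Subsingleton.elim _ _)
    rw [this]
    simp
  | succ m ih =>
    have hcons : Measurable fun p : V × (Fin m → V) => (Fin.cons p.1 p.2 : Fin (m + 1) → V) := by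
      refine measurable_pi_lambda _ fun i => ?_
      refine Fin.cases ?_ (fun j => ?_) i
      · simpa using measurable_fst
      · simp only [Fin.cons_succ]
        exact (measurable_pi_apply j).comp measurable_snd
    have key : ∀ F : (Fin (m + 1) → V) → ℝ, ∫ x, F x ∂(Measure.pi fun _ => μ) =
        ∫ p, F (Fin.cons p.1 p.2) ∂(μ.prod (Measure.pi fun _ : Fin m => μ)) := by
      intro F
      rw [← ((measurePreserving_piFinSuccAbove (fun _ : Fin (m + 1) => μ) 0).symm).integral_comp' F]
      refine integral_congr_ae (.of_forall fun p => ?_)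
      simp [MeasurableEquiv.piFinSuccAbove, Fin.insertNthEquiv]
    have hfm : Measurable fun p : V × (Fin m → V) => f (Fin.cons p.1 p.2) := hf.comp hcons
    have hem : Measurable fun p : V × (Fin m → V) => Real.exp (r * f (Fin.cons p.1 p.2)) :=
      (hfm.const_mul r).exp
    have hfi : Integrable (fun p : V × (Fin m → V) => f (Fin.cons p.1 p.2))
        (μ.prod (Measure.pi fun _ : Fin m => μ)) :=
      integrable_of_abs_le hfm fun p => hC _
    have hexpC : ∀ x, |Real.exp (r * f x)| ≤ Real.exp (|r| * C) := fun x => by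
      rw [Real.abs_exp]
      refine Real.exp_le_exp.2 ((le_abs_self _).trans ?_)
      rw [abs_mul]
      exact mul_le_mul_of_nonneg_left (hC x) (abs_nonneg _)
    have hei : Integrable (fun p : V × (Fin m → V) => Real.exp (r * f (Fin.cons p.1 p.2)))
        (μ.prod (Measure.pi fun _ : Fin m => μ)) :=
      integrable_of_abs_le hem fun p => hexpC _
    rw [key, key, integral_prod _ hfi, integral_prod _ hei]
    -- Averaging out all coordinates but the first leaves a function of oscillation at most c. The
    -- induction hypothesis handles the slices around g, and the one-variable bound handles g around
    -- its mean.
    set g : V → ℝ := fun y => ∫ x, f (Fin.cons y x) ∂(Measure.pi fun _ : Fin m => μ) with hgdef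
    have hslice : ∀ y, Measurable fun x : Fin m → V => f (Fin.cons y x) := fun y =>
      hfm.comp measurable_prodMk_left
    have hslice_int : ∀ y, Integrable (fun x : Fin m → V => f (Fin.cons y x))
        (Measure.pi fun _ : Fin m => μ) := fun y => integrable_of_abs_le (hslice y) fun x => hC _
    have hg : Measurable g := hfm.stronglyMeasurable.integral_prod_right.measurable
    have hosc : ∀ y z, |g y - g z| ≤ c := fun y z => by
      rw [hgdef]
      simp only
      rw [← integral_sub (hslice_int y) (hslice_int z)]
      have := norm_integral_le_of_norm_le_const (μ := Measure.pi fun _ : Fin m => μ)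
        (f := fun x : Fin m → V => f (Fin.cons y x) - f (Fin.cons z x)) (C := c)
        (.of_forall fun x => by
          have := hd (Fin.cons z x) 0 y
          rwa [Fin.update_cons_zero] at this)
      simpa using this
    have hgC : ∀ y, |g y| ≤ C := fun y => by
      have := norm_integral_le_of_norm_le_const (μ := Measure.pi fun _ : Fin m => μ)
        (f := fun x : Fin m → V => f (Fin.cons y x)) (C := C) (.of_forall fun x => hC _)
      simpa using this
    have hinner : ∀ y, ∫ x, Real.exp (r * f (Fin.cons y x)) ∂(Measure.pi fun _ : Fin m => μ) ≤
        Real.exp (r * g y) * Real.exp (m * (c ^ 2 * r ^ 2 / 2)) := fun y => by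
      rw [← Real.exp_add]
      refine ih (fun x => f (Fin.cons y x)) (hslice y) (fun x => hC _) fun x i z => ?_
      have := hd (Fin.cons y x) i.succ z
      rwa [← Fin.cons_update] at this
    have hgexp : Integrable (fun y => Real.exp (r * g y)) μ :=
      integrable_of_abs_le (C := Real.exp (|r| * C)) (hg.const_mul r).exp fun y => by
        rw [Real.abs_exp]
        refine Real.exp_le_exp.2 ((le_abs_self _).trans ?_)
        rw [abs_mul]
        exact mul_le_mul_of_nonneg_left (hgC y) (abs_nonneg _)
    calc _ ≤ ∫ y, Real.exp (r * g y) * Real.exp (m * (c ^ 2 * r ^ 2 / 2)) ∂μ :=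
          integral_mono hei.integral_prod_left (hgexp.mul_const _) hinner
      _ = (∫ y, Real.exp (r * g y) ∂μ) * Real.exp (m * (c ^ 2 * r ^ 2 / 2)) :=
          integral_mul_const _ _
      _ ≤ Real.exp (r * ∫ y, g y ∂μ + c ^ 2 * r ^ 2 / 2) * Real.exp (m * (c ^ 2 * r ^ 2 / 2)) :=
          mul_le_mul_of_nonneg_right (integral_exp_le_of_oscillation μ hg hosc r)
            (Real.exp_pos _).le
      _ = _ := by
          rw [← Real.exp_add]
          congr 1
          push_cast
          ring

/-- A **bounded differences inequality** on a product space. -/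
theorem measure_le_of_bounded_differences (μ : Measure V) [IsProbabilityMeasure μ]
    {c : ℝ} (hc : 0 < c) {m : ℕ} (hm : m ≠ 0) (f : (Fin m → V) → ℝ) (hf : Measurable f)
    {C : ℝ} (hC : ∀ x, |f x| ≤ C)
    (hd : ∀ x i y, |f (Function.update x i y) - f x| ≤ c) {t : ℝ} (ht : 0 < t) :
    ENNReal.ofReal (1 - Real.exp (-t ^ 2 / 2)) ≤ (Measure.pi fun _ => μ)
      {x | f x ≤ (∫ x, f x ∂(Measure.pi fun _ => μ)) + c * t * √(m : ℝ)} := by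
  set ρ : Measure (Fin m → V) := Measure.pi fun _ => μ
  set a : ℝ := (∫ x, f x ∂ρ) + c * t * √(m : ℝ) with ha
  have hm1 : (0 : ℝ) < m := by positivity
  have hm0 : (0 : ℝ) < √(m : ℝ) := Real.sqrt_pos.2 hm1
  have hm2 : √(m : ℝ) ^ 2 = m := Real.sq_sqrt (Nat.cast_nonneg m)
  -- This r minimises the Chernoff exponent -r c t √m + m c² r² / 2, with minimum -t²/2.
  set r : ℝ := t / (c * √(m : ℝ)) with hr
  have hr0 : 0 ≤ r := by positivity
  have hmgf := integral_exp_le_of_bounded_differences μ r f hf hC hd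
  have hint : Integrable (fun x => Real.exp (r * f x)) ρ :=
    integrable_of_abs_le (C := Real.exp (r * C)) (hf.const_mul r).exp fun x => by
      rw [Real.abs_exp]
      exact Real.exp_le_exp.2 (mul_le_mul_of_nonneg_left ((le_abs_self _).trans (hC x)) hr0)
  have hch := measure_ge_le_exp_mul_mgf (μ := ρ) (X := f) a hr0 hint
  have htail : ρ.real {x | a ≤ f x} ≤ Real.exp (-t ^ 2 / 2) := by
    refine hch.trans ((mul_le_mul_of_nonneg_left hmgf (Real.exp_pos _).le).trans_eq ?_)
    rw [← Real.exp_add]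
    congr 1
    have h1 : r * (c * t * √(m : ℝ)) = t ^ 2 := by
      rw [hr]; field_simp
    have h2 : (m : ℝ) * (c ^ 2 * r ^ 2 / 2) = t ^ 2 / 2 := by
      rw [hr, div_pow, mul_pow, hm2]; field_simp
    rw [h2, ha]
    linear_combination -h1
  have hcompl : {x | f x ≤ a} = {x | a < f x}ᶜ := by ext x; simp
  rw [hcompl, ← ofReal_measureReal, probReal_compl_eq_one_sub (measurableSet_lt measurable_const hf)]
  refine ENNReal.ofReal_le_ofReal ?_
  have : ρ.real {x | a < f x} ≤ ρ.real {x | a ≤ f x} :=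
    measureReal_mono fun x (hx : a < f x) => hx.le
  linarith

end BoundedDifferences

/-! ### Symmetrization with a ghost sample -/

section Symmetrization

variable {V : Type*} [MeasurableSpace V]

lemma bddAbove_range_of_abs_le {ι : Type*} {F : ι → ℝ} {C : ℝ} (hC : ∀ n, |F n| ≤ C) :
    BddAbove (Set.range F) :=
  ⟨C, by rintro _ ⟨n, rfl⟩; exact (le_abs_self _).trans (hC n)⟩

lemma abs_iSup_le {ι : Type*} [Nonempty ι] {F : ι → ℝ} {C : ℝ} (hC : ∀ n, |F n| ≤ C) :
    |⨆ n, F n| ≤ C := by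
  obtain ⟨n⟩ := ‹Nonempty ι›
  refine abs_le.2 ⟨(abs_le.1 (hC n)).1.trans (le_ciSup (bddAbove_range_of_abs_le hC) n), ?_⟩
  have : Nonempty ι := ⟨n⟩
  exact ciSup_le fun n => (le_abs_self _).trans (hC n)

lemma abs_sum_le_card_mul {m : ℕ} {F : Fin m → ℝ} {C : ℝ} (hC : ∀ i, |F i| ≤ C) :
    |∑ i, F i| ≤ m * C :=
  (Finset.abs_sum_le_sum_abs _ _).trans
    ((Finset.sum_le_sum fun i _ => hC i).trans_eq (by simp))

/-- Exchange the `i`-th entries of two tuples for all `i` with `s i = false`. -/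
def coordSwap {m : ℕ} (s : Fin m → Bool) (p : (Fin m → V) × (Fin m → V)) :
    (Fin m → V) × (Fin m → V) :=
  (fun i => if s i then p.1 i else p.2 i, fun i => if s i then p.2 i else p.1 i)

/-- Regrouped as m independent pairs, the two samples have law (μ ⊗ μ)^m, and each factor is
invariant under swapping its two entries. -/
lemma measurePreserving_coordSwap (μ : Measure V) [SigmaFinite μ] {m : ℕ} (s : Fin m → Bool) :
    MeasurePreserving (coordSwap s)
      ((Measure.pi fun _ => μ).prod (Measure.pi fun _ => μ))
      ((Measure.pi fun _ => μ).prod (Measure.pi fun _ => μ)) := by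
  have e := measurePreserving_arrowProdEquivProdArrow V V (Fin m) (fun _ => μ) (fun _ => μ)
  have hs : MeasurePreserving
      (fun (a : Fin m → V × V) i => (if s i then id else Prod.swap : V × V → V × V) (a i))
      (Measure.pi fun _ => μ.prod μ) (Measure.pi fun _ => μ.prod μ) := by
    refine measurePreserving_pi _ _ fun i => ?_
    cases s i
    · simpa using Measure.measurePreserving_swap
    · simpa using MeasurePreserving.id _
  have h := (e.comp hs).comp (e.symm _)
  convert h using 1
  funext p
  refine Prod.ext (funext fun i => ?_) (funext fun i => ?_) <;>
  · cases hi : s i <;>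
      simp [coordSwap, hi, MeasurableEquiv.arrowProdEquivProdArrow, Equiv.arrowProdEquivProdArrow]

/-- **Symmetrization** for a sequence of uniformly bounded functions. -/
theorem symmetrization (μ : Measure V) [IsProbabilityMeasure μ] {m : ℕ} {f : ℕ → V → ℝ}
    (hf : ∀ n, Measurable (f n)) {C : ℝ} (hC : ∀ n y, |f n y| ≤ C) :
    2 ^ m * ∫ x, ⨆ n, ∑ i : Fin m, ((∫ y, f n y ∂μ) - f n (x i)) ∂(Measure.pi fun _ => μ) ≤
      2 * ∑ s : Fin m → Bool,
        ∫ x, ⨆ n, ∑ i, boolSign (s i) * f n (x i) ∂(Measure.pi fun _ => μ) := by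
  set ρ : Measure (Fin m → V) := Measure.pi fun _ => μ
  have hfi : ∀ n (i : Fin m), Measurable fun x : Fin m → V => f n (x i) := fun n i =>
    (hf n).comp (measurable_pi_apply i)
  set A : (Fin m → Bool) → (Fin m → V) → ℝ := fun s x => ⨆ n, ∑ i, boolSign (s i) * f n (x i)
  have hAb : ∀ (s : Fin m → Bool) (x : Fin m → V) n,
      |∑ i, boolSign (s i) * f n (x i)| ≤ m * C := fun s x n =>
    abs_sum_le_card_mul fun i => by rw [abs_mul, abs_boolSign, one_mul]; exact hC _ _
  have hAm : ∀ s, Measurable (A s) := fun s =>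
    Measurable.iSup fun n => Finset.measurable_sum _ fun i _ => (hfi n i).const_mul _
  have hAi : ∀ s, Integrable (A s) ρ := fun s =>
    integrable_of_abs_le (hAm s) fun x => abs_iSup_le (hAb s x)
  set H : (Fin m → V) × (Fin m → V) → ℝ := fun p => ⨆ n, ∑ i, (f n (p.2 i) - f n (p.1 i))
  have hHb : ∀ (p : (Fin m → V) × (Fin m → V)) n,
      |∑ i, (f n (p.2 i) - f n (p.1 i))| ≤ m * (C + C) := fun p n =>
    abs_sum_le_card_mul fun i => (abs_sub _ _).trans (add_le_add (hC _ _) (hC _ _))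
  have hHm : Measurable H := Measurable.iSup fun n => Finset.measurable_sum _ fun i _ =>
    ((hfi n i).comp measurable_snd).sub ((hfi n i).comp measurable_fst)
  have hHi : Integrable H (ρ.prod ρ) := integrable_of_abs_le hHm fun p => abs_iSup_le (hHb p)
  have hHslice : ∀ x, Integrable (fun x' => H (x, x')) ρ := fun x =>
    integrable_of_abs_le (hHm.comp measurable_prodMk_left) fun x' => abs_iSup_le (hHb _)
  have hfint : ∀ n, |∫ y, f n y ∂μ| ≤ C := fun n => by
    simpa using norm_integral_le_of_norm_le_const (μ := μ) (f := f n) (C := C)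
      (.of_forall fun y => hC n y)
  have hint : ∀ n (i : Fin m), Integrable (fun x : Fin m → V => f n (x i)) ρ := fun n i =>
    integrable_of_abs_le (hfi n i) fun x => hC _ _
  have hsub : ∀ n (x : Fin m → V) (i : Fin m),
      Integrable (fun x' : Fin m → V => f n (x' i) - f n (x i)) ρ := fun n x i =>
    (hint n i).sub (integrable_const _)
  have heval : ∀ n (i : Fin m), ∫ x, f n (x i) ∂ρ = ∫ y, f n y ∂μ := fun n i => by
    have h := measurePreserving_eval (fun _ : Fin m => μ) i
    rw [← h.map_eq, integral_map h.measurable.aemeasurable (hf n).aestronglyMeasurable]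
  -- The mean is an integral over an independent ghost sample, and the supremum of integrals is at
  -- most the integral of the supremum.
  have h1 : ∫ x, ⨆ n, ∑ i : Fin m, ((∫ y, f n y ∂μ) - f n (x i)) ∂ρ ≤ ∫ p, H p ∂(ρ.prod ρ) := by
    rw [integral_prod _ hHi]
    refine integral_mono ?_ hHi.integral_prod_left fun x => ciSup_le fun n => ?_
    · refine integrable_of_abs_le (C := m * (C + C)) (Measurable.iSup fun n =>
        Finset.measurable_sum _ fun i _ => measurable_const.sub (hfi n i)) fun x =>
        abs_iSup_le fun n => abs_sum_le_card_mul fun i =>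
          (abs_sub _ _).trans (add_le_add (hfint n) (hC _ _))
    · calc ∑ i : Fin m, ((∫ y, f n y ∂μ) - f n (x i))
          = ∫ x', ∑ i : Fin m, (f n (x' i) - f n (x i)) ∂ρ := by
            rw [integral_finsetSum _ fun i _ => hsub n x i]
            refine Finset.sum_congr rfl fun i _ => ?_
            rw [integral_sub (hint n i) (integrable_const _), heval]
            simp
        _ ≤ ∫ x', H (x, x') ∂ρ := by
            refine integral_mono (integrable_finsetSum _ fun i _ => hsub n x i) (hHslice x) fun x' => ?_
            exact le_ciSup (bddAbove_range_of_abs_le (hHb (x, x'))) n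
  -- Swapping according to s multiplies the i-th difference by `boolSign (s i)`. The supremum of the
  -- sum then splits into one part per sample, the second with all signs flipped.
  have h2 : ∀ s : Fin m → Bool, ∫ p, H p ∂(ρ.prod ρ) ≤
      (∫ x, A s x ∂ρ) + ∫ x, A (fun i => !(s i)) x ∂ρ := by
    intro s
    have hT := measurePreserving_coordSwap μ s
    have e1 : ∫ p, H p ∂(ρ.prod ρ) = ∫ p, H (coordSwap s p) ∂(ρ.prod ρ) := by
      conv_lhs => rw [← hT.map_eq]
      exact integral_map hT.measurable.aemeasurable hHm.aestronglyMeasurable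
    have e2 : ∫ x, A s x ∂ρ = ∫ p, A s p.2 ∂(ρ.prod ρ) := by
      have := integral_fun_snd (μ := ρ) (ν := ρ) (A s)
      simpa using this.symm
    have e3 : ∫ x, A (fun i => !(s i)) x ∂ρ = ∫ p, A (fun i => !(s i)) p.1 ∂(ρ.prod ρ) := by
      have := integral_fun_fst (μ := ρ) (ν := ρ) (A fun i => !(s i))
      simpa using this.symm
    have i2 : Integrable (fun p : (Fin m → V) × (Fin m → V) => A s p.2) (ρ.prod ρ) :=
      (hAi s).comp_snd ρ
    have i3 : Integrable (fun p : (Fin m → V) × (Fin m → V) => A (fun i => !(s i)) p.1)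
        (ρ.prod ρ) := (hAi _).comp_fst ρ
    rw [e1, e2, e3, ← integral_add i2 i3]
    refine integral_mono (integrable_of_abs_le (hHm.comp hT.measurable)
      fun p => abs_iSup_le (hHb _)) (i2.add i3) fun p => ciSup_le fun n => ?_
    have l2 := le_ciSup (bddAbove_range_of_abs_le (hAb s p.2)) n
    have l3 := le_ciSup (bddAbove_range_of_abs_le (hAb (fun i => !(s i)) p.1)) n
    refine le_trans (le_of_eq ?_) (add_le_add l2 l3)
    rw [← Finset.sum_add_distrib]
    refine Finset.sum_congr rfl fun i _ => ?_
    cases hi : s i <;> simp [coordSwap, hi] <;> ring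
  -- Flipping all signs permutes the patterns, so both parts have the same total.
  have h3 : ∑ s : Fin m → Bool, ∫ x, A (fun i => !(s i)) x ∂ρ = ∑ s, ∫ x, A s x ∂ρ :=
    (Equiv.arrowCongr (Equiv.refl (Fin m)) Equiv.boolNot).sum_comp fun s => ∫ x, A s x ∂ρ
  calc 2 ^ m * ∫ x, ⨆ n, ∑ i : Fin m, ((∫ y, f n y ∂μ) - f n (x i)) ∂ρ
      ≤ 2 ^ m * ∫ p, H p ∂(ρ.prod ρ) := mul_le_mul_of_nonneg_left h1 (by positivity)
    _ = ∑ _s : Fin m → Bool, ∫ p, H p ∂(ρ.prod ρ) := by simp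
    _ ≤ ∑ s, ((∫ x, A s x ∂ρ) + ∫ x, A (fun i => !(s i)) x ∂ρ) :=
        Finset.sum_le_sum fun s _ => h2 s
    _ = 2 * ∑ s, ∫ x, A s x ∂ρ := by rw [Finset.sum_add_distrib, h3, two_mul]

end Symmetrization

/-! ### Joint law of the sample and the signs -/

section Laws

/-- The uniform distribution on `Bool`. -/
noncomputable def uniformBool : Measure Bool :=
  (1 / 2 : ℝ≥0∞) • Measure.dirac true + (1 / 2 : ℝ≥0∞) • Measure.dirac false

lemma uniformBool_singleton (b : Bool) : uniformBool {b} = 1 / 2 := by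
  cases b <;> simp [uniformBool]

instance : IsProbabilityMeasure uniformBool :=
  ⟨by simp [uniformBool, ENNReal.inv_two_add_inv_two]⟩

/-- The two prescribed atoms already carry mass 1, so they determine the law. -/
lemma IsRademacher.map_eq {Ω : Type*} [MeasurableSpace Ω] {P : Measure Ω}
    [IsProbabilityMeasure P] {ε : Ω → ℝ} (h : IsRademacher P ε) :
    P.map ε = uniformBool.map boolSign := by
  have : IsProbabilityMeasure (P.map ε) := Measure.isProbabilityMeasure_map h.aemeasurable
  have h1 : P.map ε {1} = 1 / 2 := by
    rw [Measure.map_apply_of_aemeasurable h.aemeasurable (measurableSet_singleton _)]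
    exact h.prob_one
  have h2 : P.map ε {-1} = 1 / 2 := by
    rw [Measure.map_apply_of_aemeasurable h.aemeasurable (measurableSet_singleton _)]
    exact h.prob_neg_one
  have hdisj : Disjoint ({1} : Set ℝ) {-1} := by
    rw [Set.disjoint_singleton]; norm_num
  have hfull : ∀ᵐ x ∂(P.map ε), x ∈ ({1} ∪ {-1} : Set ℝ) := by
    refine (mem_ae_iff_prob_eq_one ((measurableSet_singleton _).union
      (measurableSet_singleton _))).2 ?_
    rw [measure_union hdisj (measurableSet_singleton _), h1, h2, ENNReal.add_halves]
  rw [← Measure.restrict_eq_self_of_ae_mem hfull,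
    Measure.restrict_union hdisj (measurableSet_singleton _), Measure.restrict_singleton,
    Measure.restrict_singleton, h1, h2, uniformBool,
    Measure.map_add _ _ (measurable_of_finite _), Measure.map_smul, Measure.map_smul,
    Measure.map_dirac, Measure.map_dirac]
  simp

lemma lintegral_pi_uniformBool {m : ℕ} (F : (Fin m → Bool) → ℝ≥0∞) :
    ∫⁻ s, F s ∂(Measure.pi fun _ => uniformBool) = (2 ^ m)⁻¹ * ∑ s, F s := by
  rw [lintegral_fintype, Finset.mul_sum]
  refine Finset.sum_congr rfl fun s _ => ?_
  rw [Measure.pi_singleton]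
  simp [uniformBool_singleton, mul_comm, ENNReal.inv_pow]

/-- Integrals against the joint law of an i.i.d. sample and independent random signs. -/
theorem lintegral_sample_signs {Ω V : Type*} [MeasurableSpace Ω] [MeasurableSpace V]
    {P : Measure Ω} [IsProbabilityMeasure P] {μ : Measure V} [IsProbabilityMeasure μ]
    {m : ℕ} {X : Fin m → Ω → V} {ε : Fin m → Ω → ℝ}
    (hX : ∀ i, AEMeasurable (X i) P) (hlaw : P.map (fun ω i => X i ω) = Measure.pi fun _ => μ)
    (hε : ∀ i, IsRademacher P (ε i)) (hind : iIndepFun ε P)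
    (hjoint : IndepFun (fun ω i => X i ω) (fun ω i => ε i ω) P)
    {F : (Fin m → V) → (Fin m → ℝ) → ℝ≥0∞} (hF : Measurable (Function.uncurry F)) :
    ∫⁻ ω, F (fun i => X i ω) (fun i => ε i ω) ∂P =
      (2 ^ m)⁻¹ * ∑ s : Fin m → Bool,
        ∫⁻ x, F x (fun i => boolSign (s i)) ∂(Measure.pi fun _ => μ) := by
  have hXm : AEMeasurable (fun ω i => X i ω) P := aemeasurable_pi_lambda _ hX
  have hεm : AEMeasurable (fun ω i => ε i ω) P :=
    aemeasurable_pi_lambda _ fun i => (hε i).aemeasurable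
  have hb : Measurable boolSign := measurable_of_finite _
  have : IsProbabilityMeasure (uniformBool.map boolSign) :=
    Measure.isProbabilityMeasure_map hb.aemeasurable
  have hsigns : P.map (fun ω i => ε i ω) =
      (Measure.pi fun _ : Fin m => uniformBool).map fun s i => boolSign (s i) := by
    rw [(iIndepFun_iff_map_fun_eq_pi_map fun i => (hε i).aemeasurable).1 hind,
      Measure.pi_map_pi fun _ => hb.aemeasurable]
    exact congrArg _ (funext fun i => (hε i).map_eq)
  have hpair := (indepFun_iff_map_prod_eq_prod_map_map hXm hεm).1 hjoint
  have hbm : Measurable fun (s : Fin m → Bool) i => boolSign (s i) := measurable_of_finite _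
  have : IsProbabilityMeasure
      ((Measure.pi fun _ : Fin m => uniformBool).map fun s i => boolSign (s i)) :=
    Measure.isProbabilityMeasure_map hbm.aemeasurable
  calc ∫⁻ ω, F (fun i => X i ω) (fun i => ε i ω) ∂P
      = ∫⁻ p, Function.uncurry F p ∂(P.map fun ω => ((fun i => X i ω), (fun i => ε i ω))) := by
        rw [lintegral_map' hF.aemeasurable (hXm.prodMk hεm)]
        rfl
    _ = ∫⁻ r, ∫⁻ x, F x r ∂(Measure.pi fun _ => μ)
          ∂((Measure.pi fun _ : Fin m => uniformBool).map fun s i => boolSign (s i)) := by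
        rw [hpair, hlaw, hsigns, lintegral_prod_symm _ hF.aemeasurable]
        rfl
    _ = _ := by
        have hFr : Measurable fun r => ∫⁻ x, F x r ∂(Measure.pi fun _ : Fin m => μ) :=
          hF.lintegral_prod_left'
        rw [lintegral_map hFr hbm, lintegral_pi_uniformBool]

end Laws

/-! ### Reduction to countable index sets -/

section DenseSequence

variable {V : Type*} [TopologicalSpace V]

/-- Replaces an arbitrary, possibly uncountable E by a sequence in it, so that the suprema become
measurable. -/
lemma exists_seq_dense [SecondCountableTopology V] {E : Set V} (hE : E.Nonempty) :
    ∃ v : ℕ → V, (∀ n, v n ∈ E) ∧ E ⊆ closure (Set.range v) := by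
  have : Nonempty E := hE.to_subtype
  refine ⟨fun n => (TopologicalSpace.denseSeq E n : V), fun n => Subtype.coe_prop _, fun u hu => ?_⟩
  have h := TopologicalSpace.denseRange_denseSeq E ⟨u, hu⟩
  have := image_closure_subset_closure_image continuous_subtype_val ⟨_, h, rfl⟩
  rwa [← Set.range_comp] at this

lemma biSup_eq_iSup_seq {E : Set V} {v : ℕ → V} (hv : ∀ n, v n ∈ E)
    (hE : E ⊆ closure (Set.range v)) {f : V → ℝ} (hf : Continuous f) :
    ⨆ u ∈ E, (f u : EReal) = ⨆ n, (f (v n) : EReal) := by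
  refine le_antisymm (iSup₂_le fun u hu => ?_) (iSup_le fun n => le_iSup₂_of_le (v n) (hv n) le_rfl)
  have hcl : IsClosed {u | (f u : EReal) ≤ ⨆ n, (f (v n) : EReal)} :=
    isClosed_le (continuous_coe_real_ereal.comp hf) continuous_const
  exact closure_minimal (by rintro _ ⟨n, rfl⟩; exact le_iSup (fun n => (f (v n) : EReal)) n) hcl
    (hE hu)

lemma le_biInf_of_seq {E : Set V} {v : ℕ → V} (hE : E ⊆ closure (Set.range v)) {f : V → ℝ}
    (hf : Continuous f) {c : EReal} (hc : ∀ n, c ≤ f (v n)) : c ≤ ⨅ u ∈ E, (f u : EReal) := by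
  refine le_iInf₂ fun u hu => ?_
  have hcl : IsClosed {u | c ≤ (f u : EReal)} :=
    isClosed_le continuous_const (continuous_coe_real_ereal.comp hf)
  exact closure_minimal (by rintro _ ⟨n, rfl⟩; exact hc n) hcl (hE hu)

end DenseSequence

/-! ### Truncation of the marginals -/

section Truncation

/-- The soft threshold `s ↦ min ξ (|s| - ξ)₊`. -/
noncomputable def softThreshold (ξ s : ℝ) : ℝ := max 0 (min ξ (|s| - ξ))

lemma softThreshold_nonneg (ξ s : ℝ) : 0 ≤ softThreshold ξ s := le_max_left _ _

lemma softThreshold_le {ξ : ℝ} (hξ : 0 ≤ ξ) (s : ℝ) : softThreshold ξ s ≤ ξ :=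
  max_le hξ (min_le_left _ _)

lemma abs_softThreshold_le {ξ : ℝ} (hξ : 0 ≤ ξ) (s : ℝ) : |softThreshold ξ s| ≤ ξ := by
  rw [abs_of_nonneg (softThreshold_nonneg ξ s)]
  exact softThreshold_le hξ s

lemma softThreshold_le_abs {ξ : ℝ} (hξ : 0 ≤ ξ) (s : ℝ) : softThreshold ξ s ≤ |s| :=
  max_le (abs_nonneg s) ((min_le_right _ _).trans (sub_le_self _ hξ))

/-- This is where the level 2ξ of the marginal tail enters. -/
lemma softThreshold_of_le {ξ s : ℝ} (hξ : 0 ≤ ξ) (h : 2 * ξ ≤ |s|) : softThreshold ξ s = ξ := by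
  rw [softThreshold, min_eq_left (by linarith), max_eq_right hξ]

lemma abs_softThreshold_sub_le (ξ x y : ℝ) :
    |softThreshold ξ x - softThreshold ξ y| ≤ |x - y| :=
  calc |max 0 (min ξ (|x| - ξ)) - max 0 (min ξ (|y| - ξ))|
      ≤ |min ξ (|x| - ξ) - min ξ (|y| - ξ)| := by
        simpa using abs_max_sub_max_le_max 0 (min ξ (|x| - ξ)) 0 (min ξ (|y| - ξ))
    _ ≤ |(|x| - ξ) - (|y| - ξ)| := by
        simpa using abs_min_sub_min_le_max ξ (|x| - ξ) ξ (|y| - ξ)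
    _ = |(|x| - |y|)| := by ring_nf
    _ ≤ |x - y| := abs_abs_sub_abs_le _ _

lemma measurable_softThreshold (ξ : ℝ) : Measurable (softThreshold ξ) := by
  unfold softThreshold
  fun_prop

end Truncation

/-! ### From extended-real to real suprema -/

section IntegrableSup

/-- A supremum over ℕ is never ⊥, so once it is not ⊤ it is a real upper bound and the real supremum
is not a default value. -/
lemma bddAbove_and_iSup_coe {F : ℕ → ℝ} (h : ⨆ n, (F n : EReal) ≠ ⊤) :
    BddAbove (Set.range F) ∧ ⨆ n, (F n : EReal) = ((⨆ n, F n : ℝ) : EReal) := by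
  have hle : ∀ n, (F n : EReal) ≤ ⨆ n, (F n : EReal) := fun n => le_iSup (fun n => (F n : EReal)) n
  have hbot : ⨆ n, (F n : EReal) ≠ ⊥ := fun hb => by
    have := hle 0
    rw [hb, le_bot_iff] at this
    exact EReal.coe_ne_bot _ this
  have hle' : ∀ n, F n ≤ (⨆ n, (F n : EReal)).toReal := fun n => by
    have := hle n
    rwa [← EReal.coe_toReal h hbot, EReal.coe_le_coe_iff] at this
  have hb : BddAbove (Set.range F) :=
    ⟨(⨆ n, (F n : EReal)).toReal, by rintro _ ⟨n, rfl⟩; exact hle' n⟩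
  refine ⟨hb, le_antisymm (iSup_le fun n => ?_) ?_⟩
  · exact EReal.coe_le_coe_iff.2 (le_ciSup hb n)
  · rw [← EReal.coe_toReal h hbot, EReal.coe_le_coe_iff]
    exact ciSup_le hle'

/-- A finite positive part forces the extended supremum below ⊤ almost everywhere; there it agrees
with the real one, whose positive and negative parts are thus both integrable. -/
lemma integrable_iSup_of_lintegral_ne_top {α : Type*} [MeasurableSpace α] {μ : Measure α}
    {F : ℕ → α → ℝ} (hF : ∀ n, Measurable (F n))
    (hpos : ∫⁻ x, (⨆ n, (F n x : EReal)).toENNReal ∂μ ≠ ∞)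
    (hneg : ∫⁻ x, (-⨆ n, (F n x : EReal)).toENNReal ∂μ ≠ ∞) :
    (∀ᵐ x ∂μ, BddAbove (Set.range fun n => F n x)) ∧ Integrable (fun x => ⨆ n, F n x) μ ∧
      ∫ x, ⨆ n, F n x ∂μ = (∫⁻ x, (⨆ n, (F n x : EReal)).toENNReal ∂μ).toReal -
        (∫⁻ x, (-⨆ n, (F n x : EReal)).toENNReal ∂μ).toReal := by
  have hm : Measurable fun x => ⨆ n, F n x := Measurable.iSup hF
  have hmE : Measurable fun x => (⨆ n, (F n x : EReal)).toENNReal :=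
    (Measurable.iSup fun n => (hF n).coe_real_ereal).ereal_toENNReal
  have hne : ∀ᵐ x ∂μ, ⨆ n, (F n x : EReal) ≠ ⊤ := by
    filter_upwards [ae_lt_top hmE hpos] with x hx
    exact EReal.toENNReal_ne_top_iff.1 hx.ne
  have hgpos : ∫⁻ x, ENNReal.ofReal (⨆ n, F n x) ∂μ =
      ∫⁻ x, (⨆ n, (F n x : EReal)).toENNReal ∂μ := by
    refine lintegral_congr_ae ?_
    filter_upwards [hne] with x hx
    rw [(bddAbove_and_iSup_coe hx).2, EReal.real_coe_toENNReal]
  have hgneg : ∫⁻ x, ENNReal.ofReal (-⨆ n, F n x) ∂μ =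
      ∫⁻ x, (-⨆ n, (F n x : EReal)).toENNReal ∂μ := by
    refine lintegral_congr_ae ?_
    filter_upwards [hne] with x hx
    rw [(bddAbove_and_iSup_coe hx).2, ← EReal.coe_neg, EReal.real_coe_toENNReal]
  have hgi : Integrable (fun x => ⨆ n, F n x) μ := by
    refine ⟨hm.aestronglyMeasurable, ?_⟩
    refine lt_of_le_of_lt ?_ (ENNReal.add_lt_top.2 ⟨hpos.lt_top, hneg.lt_top⟩)
    rw [← hgpos, ← hgneg, ← lintegral_add_left hm.ennreal_ofReal]
    refine lintegral_mono fun x => ?_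
    rw [Real.enorm_eq_ofReal_abs]
    rcases abs_choice (⨆ n, F n x) with h | h <;> rw [h]
    · exact le_self_add
    · exact le_add_self
  refine ⟨hne.mono fun x hx => (bddAbove_and_iSup_coe hx).1, hgi, ?_⟩
  rw [integral_eq_lintegral_pos_part_sub_lintegral_neg_part hgi, hgpos, hgneg]

end IntegrableSup

/-! ### The width as an average over sign patterns -/

section Width

variable {d m : ℕ}

/-- The value of `m^{-1/2} ∑ᵢ ⟨u, rᵢ xᵢ⟩`. -/
noncomputable def signedInner (u : EuclideanSpace ℝ (Fin d)) (x : Fin m → EuclideanSpace ℝ (Fin d))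
    (r : Fin m → ℝ) : ℝ :=
  inner ℝ u ((1 / √(m : ℝ)) • ∑ i, r i • x i)

lemma signedInner_eq (u : EuclideanSpace ℝ (Fin d)) (x : Fin m → EuclideanSpace ℝ (Fin d))
    (r : Fin m → ℝ) : signedInner u x r = (1 / √(m : ℝ)) * ∑ i, r i * inner ℝ u (x i) := by
  simp only [signedInner, inner_smul_right, inner_sum]

lemma signedInner_neg (u : EuclideanSpace ℝ (Fin d)) (x : Fin m → EuclideanSpace ℝ (Fin d))
    (r : Fin m → ℝ) : signedInner u x (fun i => -r i) = -signedInner u x r := by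
  simp [signedInner_eq]

lemma measurable_signedInner (u : EuclideanSpace ℝ (Fin d)) :
    Measurable (Function.uncurry (signedInner (m := m) u)) := by
  unfold Function.uncurry signedInner
  fun_prop

lemma measurable_signedInner_left (u : EuclideanSpace ℝ (Fin d)) (r : Fin m → ℝ) :
    Measurable fun x => signedInner u x r := by
  unfold signedInner
  fun_prop

/-- Either the width of a sequence is infinite, or it is the mean of the integrals of the
suprema over all sign patterns. -/
theorem expectation_iSup_signedInner {Ω : Type*} [MeasurableSpace Ω]
    {P : Measure Ω} [IsProbabilityMeasure P] {μ : Measure (EuclideanSpace ℝ (Fin d))}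
    [IsProbabilityMeasure μ]
    {X : Fin m → Ω → EuclideanSpace ℝ (Fin d)} {ε : Fin m → Ω → ℝ}
    (hX : ∀ i, AEMeasurable (X i) P) (hlaw : P.map (fun ω i => X i ω) = Measure.pi fun _ => μ)
    (hε : ∀ i, IsRademacher P (ε i)) (hind : iIndepFun ε P)
    (hjoint : IndepFun (fun ω i => X i ω) (fun ω i => ε i ω) P)
    (v : ℕ → EuclideanSpace ℝ (Fin d))
    (hexists : ExpectationExists P fun ω =>
      ⨆ n, (signedInner (v n) (fun i => X i ω) (fun i => ε i ω) : EReal)) :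
    expectation P (fun ω =>
        ⨆ n, (signedInner (v n) (fun i => X i ω) (fun i => ε i ω) : EReal)) = ⊤ ∨
      ((∀ᵐ x ∂(Measure.pi fun _ : Fin m => μ), ∀ s : Fin m → Bool,
          BddAbove (Set.range fun n => signedInner (v n) x fun i => boolSign (s i))) ∧
        (∀ s : Fin m → Bool, Integrable
          (fun x => ⨆ n, signedInner (v n) x fun i => boolSign (s i))
          (Measure.pi fun _ => μ)) ∧
        expectation P (fun ω =>
            ⨆ n, (signedInner (v n) (fun i => X i ω) (fun i => ε i ω) : EReal)) =
          (((2 ^ m)⁻¹ * ∑ s : Fin m → Bool,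
            ∫ x, ⨆ n, signedInner (v n) x (fun i => boolSign (s i))
              ∂(Measure.pi fun _ => μ) : ℝ) : EReal)) := by
  set ρ : Measure (Fin m → EuclideanSpace ℝ (Fin d)) := Measure.pi fun _ => μ
  set G : (Fin m → EuclideanSpace ℝ (Fin d)) → (Fin m → ℝ) → EReal := fun x r =>
    ⨆ n, (signedInner (v n) x r : EReal)
  have hG : Measurable (Function.uncurry G) :=
    Measurable.iSup fun n => (measurable_signedInner (v n)).coe_real_ereal
  set σ : (Fin m → Bool) → Fin m → ℝ := fun s i => boolSign (s i)
  set pos : (Fin m → Bool) → ℝ≥0∞ := fun s => ∫⁻ x, (G x (σ s)).toENNReal ∂ρ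
  set neg : (Fin m → Bool) → ℝ≥0∞ := fun s => ∫⁻ x, (-G x (σ s)).toENNReal ∂ρ
  have hpos : ∫⁻ ω, (G (fun i => X i ω) (fun i => ε i ω)).toENNReal ∂P =
      (2 ^ m)⁻¹ * ∑ s, pos s :=
    lintegral_sample_signs hX hlaw hε hind hjoint (F := fun x r => (G x r).toENNReal)
      (measurable_ereal_toENNReal.comp hG)
  have hneg : ∫⁻ ω, (-G (fun i => X i ω) (fun i => ε i ω)).toENNReal ∂P =
      (2 ^ m)⁻¹ * ∑ s, neg s :=
    lintegral_sample_signs hX hlaw hε hind hjoint (F := fun x r => (-G x r).toENNReal)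
      (measurable_ereal_toENNReal.comp hG.neg)
  have hexp : expectation P (fun ω => G (fun i => X i ω) (fun i => ε i ω)) =
      (((2 ^ m)⁻¹ * ∑ s, pos s : ℝ≥0∞) : EReal) - (((2 ^ m)⁻¹ * ∑ s, neg s : ℝ≥0∞) : EReal) := by
    rw [expectation, hpos, hneg]
  have h2m : ((2 : ℝ≥0∞) ^ m)⁻¹ ≠ 0 := ENNReal.inv_ne_zero.2 (by simp)
  have h2m' : ((2 : ℝ≥0∞) ^ m)⁻¹ ≠ ∞ := ENNReal.inv_ne_top.2 (by positivity)
  change expectation P (fun ω => G (fun i => X i ω) (fun i => ε i ω)) = ⊤ ∨ _ ∧ _ ∧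
    expectation P (fun ω => G (fun i => X i ω) (fun i => ε i ω)) = _
  rw [hexp]
  by_cases hfin : (2 ^ m)⁻¹ * ∑ s, pos s = ∞
  · left
    have hnegfin : (2 ^ m)⁻¹ * ∑ s, neg s ≠ ∞ := by
      rcases hexists with h | h
      · exact absurd (hpos.trans hfin) h
      · exact fun h' => h (hneg.trans h')
    rw [hfin]
    lift (2 ^ m)⁻¹ * ∑ s, neg s to NNReal using hnegfin with c
    rfl
  right
  have hposfin : ∀ s, pos s ≠ ∞ := fun s hs => by
    refine hfin ?_
    rw [ENNReal.mul_eq_top]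
    exact Or.inl ⟨h2m, ENNReal.sum_eq_top.2 ⟨s, Finset.mem_univ _, hs⟩⟩
  -- Compare with the single index 0: -sup is at most minus that value, which is the value at 0 for
  -- the flipped signs and so at most the flipped supremum. Negative parts are thus dominated by
  -- positive parts of flipped patterns, and the width cannot be -∞.
  have hnegfin : ∀ s, neg s ≠ ∞ := fun s => by
    refine ne_top_of_le_ne_top (hposfin fun i => !(s i)) (lintegral_mono fun x => ?_)
    refine EReal.toENNReal_le_toENNReal ?_
    have h1 : (signedInner (v 0) x (σ fun i => !(s i)) : EReal) ≤ G x (σ fun i => !(s i)) :=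
      le_iSup (fun n => (signedInner (v n) x (σ fun i => !(s i)) : EReal)) 0
    have h2 : (signedInner (v 0) x (σ s) : EReal) ≤ G x (σ s) :=
      le_iSup (fun n => (signedInner (v n) x (σ s) : EReal)) 0
    have h3 : signedInner (v 0) x (σ fun i => !(s i)) = -signedInner (v 0) x (σ s) := by
      rw [← signedInner_neg]
      simp [σ]
    rw [h3, EReal.coe_neg] at h1
    exact (EReal.neg_le_neg_iff.2 h2).trans h1
  have hg := fun s => integrable_iSup_of_lintegral_ne_top (μ := ρ)
    (F := fun n x => signedInner (v n) x (σ s))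
    (fun n => measurable_signedInner_left (v n) (σ s)) (hposfin s) (hnegfin s)
  refine ⟨ae_all_iff.2 fun s => (hg s).1, fun s => (hg s).2.1, ?_⟩
  have hint : ∀ s, ∫ x, ⨆ n, signedInner (v n) x (σ s) ∂ρ = (pos s).toReal - (neg s).toReal :=
    fun s => (hg s).2.2
  have hnegfin' : (2 ^ m)⁻¹ * ∑ s, neg s ≠ ∞ :=
    ENNReal.mul_ne_top h2m' (ENNReal.sum_ne_top.2 fun s _ => hnegfin s)
  rw [← ENNReal.ofReal_toReal hfin, ← ENNReal.ofReal_toReal hnegfin',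
    EReal.coe_ennreal_ofReal, EReal.coe_ennreal_ofReal, max_eq_left ENNReal.toReal_nonneg,
    max_eq_left ENNReal.toReal_nonneg, ← EReal.coe_sub]
  congr 1
  rw [ENNReal.toReal_mul, ENNReal.toReal_mul, ENNReal.toReal_sum fun s _ => hposfin s,
    ENNReal.toReal_sum fun s _ => hnegfin s, ← mul_sub, ← Finset.sum_sub_distrib]
  simp only [ENNReal.toReal_inv, ENNReal.toReal_pow, ENNReal.toReal_ofNat]
  exact congrArg _ (Finset.sum_congr rfl fun s _ => (hint s).symm)

end Width

/-! ### Deviation of the truncated process -/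

lemma abs_iSup_sub_iSup_le {ι : Type*} [Nonempty ι] {F G : ι → ℝ} {C c : ℝ}
    (hF : ∀ n, |F n| ≤ C) (hG : ∀ n, |G n| ≤ C) (h : ∀ n, |F n - G n| ≤ c) :
    |(⨆ n, F n) - ⨆ n, G n| ≤ c := by
  have key : ∀ F G : ι → ℝ, (∀ n, |G n| ≤ C) → (∀ n, |F n - G n| ≤ c) →
      (⨆ n, F n) ≤ (⨆ n, G n) + c := fun F G hG h => ciSup_le fun n => by
    have h1 := le_ciSup (bddAbove_range_of_abs_le hG) n
    have h2 := (abs_le.1 (h n)).2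
    linarith
  have h1 := key F G hG h
  have h2 := key G F hF fun n => by rw [abs_sub_comm]; exact h n
  exact abs_le.2 ⟨by linarith, by linarith⟩

/-- Cauchy–Schwarz against the constant vector; for m = 0 both sides vanish. -/
lemma sum_abs_div_sqrt_le {m : ℕ} (a : Fin m → ℝ) :
    (∑ i, |a i|) / √(m : ℝ) ≤ √(∑ i, |a i| ^ 2) := by
  refine div_le_of_le_mul₀ (Real.sqrt_nonneg _) (Real.sqrt_nonneg _) ?_
  rw [← Real.sqrt_mul (Finset.sum_nonneg fun i _ => sq_nonneg _)]
  refine Real.le_sqrt_of_sq_le ?_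
  have := sq_sum_le_card_mul_sum_sq (s := Finset.univ) (f := fun i => |a i|)
  rw [Finset.card_univ, Fintype.card_fin] at this
  linarith

section Deviation

variable {d m : ℕ} (μ : Measure (EuclideanSpace ℝ (Fin d)))
  (v : ℕ → EuclideanSpace ℝ (Fin d)) (ξ : ℝ)

/-- The largest deviation of the truncated marginals below their means. -/
noncomputable def supDeviation (x : Fin m → EuclideanSpace ℝ (Fin d)) : ℝ :=
  ⨆ n, ∑ i, ((∫ y, softThreshold ξ (inner ℝ (v n) y) ∂μ) - softThreshold ξ (inner ℝ (v n) (x i)))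

lemma measurable_softThreshold_inner (u : EuclideanSpace ℝ (Fin d)) :
    Measurable fun y => softThreshold ξ (inner ℝ u y) :=
  (measurable_softThreshold ξ).comp (by fun_prop)

lemma measurable_supDeviation : Measurable (supDeviation (m := m) μ v ξ) :=
  Measurable.iSup fun n => Finset.measurable_sum _ fun i _ =>
    measurable_const.sub ((measurable_softThreshold_inner ξ (v n)).comp (measurable_pi_apply i))

variable [IsProbabilityMeasure μ] {ξ}

lemma abs_sum_deviation_le (hξ : 0 ≤ ξ) (x : Fin m → EuclideanSpace ℝ (Fin d)) (n : ℕ) :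
    |∑ i, ((∫ y, softThreshold ξ (inner ℝ (v n) y) ∂μ) -
      softThreshold ξ (inner ℝ (v n) (x i)))| ≤ m * (ξ + ξ) := by
  have hmean : |∫ y, softThreshold ξ (inner ℝ (v n) y) ∂μ| ≤ ξ := by
    simpa using norm_integral_le_of_norm_le_const (μ := μ)
      (f := fun y => softThreshold ξ (inner ℝ (v n) y)) (C := ξ)
      (.of_forall fun y => abs_softThreshold_le hξ _)
  exact abs_sum_le_card_mul fun i =>
    (abs_sub _ _).trans (add_le_add hmean (abs_softThreshold_le hξ _))

/-- Only the i-th summand changes, and two values in [0, ξ] differ by at most ξ; nonnegativity of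
the truncation avoids a constant 2ξ. -/
lemma abs_supDeviation_update_sub_le (hξ : 0 ≤ ξ) (x : Fin m → EuclideanSpace ℝ (Fin d))
    (i : Fin m) (y : EuclideanSpace ℝ (Fin d)) :
    |supDeviation μ v ξ (Function.update x i y) - supDeviation μ v ξ x| ≤ ξ := by
  refine abs_iSup_sub_iSup_le (abs_sum_deviation_le μ v hξ _) (abs_sum_deviation_le μ v hξ _)
    fun n => ?_
  rw [← Finset.sum_sub_distrib, Finset.sum_eq_single i]
  · rw [Function.update_self]
    have h1 := softThreshold_nonneg ξ (inner ℝ (v n) (x i))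
    have h2 := softThreshold_nonneg ξ (inner ℝ (v n) y)
    have h3 := softThreshold_le hξ (inner ℝ (v n) (x i))
    have h4 := softThreshold_le hξ (inner ℝ (v n) y)
    exact abs_le.2 ⟨by linarith, by linarith⟩
  · intro j _ hj
    rw [Function.update_of_ne hj, sub_self]
  · simp

/-- Symmetrization and contraction bound the mean deviation by the mean width. -/
lemma integral_supDeviation_le (hξ : 0 ≤ ξ) (hm : m ≠ 0)
    (hb : ∀ᵐ x ∂(Measure.pi fun _ : Fin m => μ), ∀ s : Fin m → Bool,
      BddAbove (Set.range fun n => signedInner (v n) x fun i => boolSign (s i)))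
    (hi : ∀ s : Fin m → Bool, Integrable
      (fun x => ⨆ n, signedInner (v n) x fun i => boolSign (s i)) (Measure.pi fun _ => μ)) :
    ∫ x, supDeviation μ v ξ x ∂(Measure.pi fun _ : Fin m => μ) ≤
      2 * √(m : ℝ) * ((2 ^ m)⁻¹ * ∑ s : Fin m → Bool,
        ∫ x, ⨆ n, signedInner (v n) x (fun i => boolSign (s i)) ∂(Measure.pi fun _ => μ)) := by
  set ρ : Measure (Fin m → EuclideanSpace ℝ (Fin d)) := Measure.pi fun _ => μ
  have hsqrt : 0 < √(m : ℝ) := Real.sqrt_pos.2 (by positivity)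
  have hsym := symmetrization (m := m) μ (f := fun n y => softThreshold ξ (inner ℝ (v n) y))
    (fun n => measurable_softThreshold_inner ξ (v n)) (fun n y => abs_softThreshold_le hξ _)
  -- Undoing the normalisation of h produces the factor √m.
  have hscale : ∀ (n : ℕ) (x : Fin m → EuclideanSpace ℝ (Fin d)) (s : Fin m → Bool),
      ∑ i, boolSign (s i) * inner ℝ (v n) (x i) =
        √(m : ℝ) * signedInner (v n) x (fun i => boolSign (s i)) := fun n x s => by
    rw [signedInner_eq]
    field_simp
  have hA : ∀ s : Fin m → Bool, Integrable (fun x : Fin m → EuclideanSpace ℝ (Fin d) =>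
      ⨆ n, ∑ i, boolSign (s i) * softThreshold ξ (inner ℝ (v n) (x i))) ρ := fun s =>
    integrable_of_abs_le (C := m * ξ) (Measurable.iSup fun n => Finset.measurable_sum _ fun i _ =>
      ((measurable_softThreshold_inner ξ (v n)).comp (measurable_pi_apply i)).const_mul _)
      fun x => abs_iSup_le fun n => abs_sum_le_card_mul fun i => by
        rw [abs_mul, abs_boolSign, one_mul]; exact abs_softThreshold_le hξ _
  have hcontr : ∑ s : Fin m → Bool,
      ∫ x, ⨆ n, ∑ i, boolSign (s i) * softThreshold ξ (inner ℝ (v n) (x i)) ∂ρ ≤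
      √(m : ℝ) * ∑ s : Fin m → Bool,
        ∫ x, ⨆ n, signedInner (v n) x (fun i => boolSign (s i)) ∂ρ := by
    rw [← integral_finsetSum _ fun s _ => hA s, ← integral_finsetSum _ fun s _ => hi s,
      ← integral_const_mul]
    refine integral_mono_ae (integrable_finsetSum _ fun s _ => hA s)
      ((integrable_finsetSum _ fun s _ => hi s).const_mul _) ?_
    filter_upwards [hb] with x hx
    have hbdd : ∀ s : Fin m → Bool, BddAbove (Set.range fun n =>
        (0 : ℝ) + ∑ i, boolSign (s i) * inner ℝ (v n) (x i)) := fun s => by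
      obtain ⟨B, hB⟩ := hx s
      refine ⟨√(m : ℝ) * B, ?_⟩
      rintro _ ⟨n, rfl⟩
      simp only [zero_add, hscale]
      exact mul_le_mul_of_nonneg_left (hB ⟨n, rfl⟩) hsqrt.le
    have h := sum_iSup_contraction (abs_softThreshold_sub_le ξ)
      (fun i n => inner ℝ (v n) (x i)) (fun _ => 0) hbdd
    simp only [zero_add] at h
    refine h.trans_eq ?_
    rw [Finset.mul_sum]
    refine Finset.sum_congr rfl fun s _ => ?_
    rw [Real.mul_iSup_of_nonneg hsqrt.le]
    exact iSup_congr fun n => hscale n x s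
  have h2 : (0 : ℝ) < 2 ^ m := by positivity
  have hle := hsym.trans (mul_le_mul_of_nonneg_left hcontr zero_le_two)
  rw [← le_div_iff₀' h2] at hle
  refine hle.trans_eq ?_
  field_simp

/-- On the event that the deviation is small, all marginals of the process are large. -/
lemma le_sqrt_of_supDeviation_le (hξ : 0 < ξ) (hm : m ≠ 0) {q b : ℝ}
    {x : Fin m → EuclideanSpace ℝ (Fin d)} (hx : supDeviation μ v ξ x ≤ b) (n : ℕ)
    (hq : q ≤ μ.real {y | 2 * ξ ≤ |inner ℝ (v n) y|}) :
    ξ * √(m : ℝ) * q - b / √(m : ℝ) ≤ √(∑ i, |inner ℝ (v n) (x i)| ^ 2) := by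
  have hsqrt : 0 < √(m : ℝ) := Real.sqrt_pos.2 (by positivity)
  -- Markov's inequality at level ξ, which the truncation attains on the event in `hq`.
  have hmean : ξ * q ≤ ∫ y, softThreshold ξ (inner ℝ (v n) y) ∂μ := by
    refine le_trans (mul_le_mul_of_nonneg_left (hq.trans ?_) hξ.le)
      (mul_meas_ge_le_integral_of_nonneg (.of_forall fun y => softThreshold_nonneg ξ _)
        (integrable_of_abs_le (measurable_softThreshold_inner ξ (v n))
          fun y => abs_softThreshold_le hξ.le _) ξ)
    exact measureReal_mono fun y (hy : 2 * ξ ≤ _) => (softThreshold_of_le hξ.le hy).ge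
  have hdev := (le_ciSup (bddAbove_range_of_abs_le (abs_sum_deviation_le μ v hξ.le x)) n).trans hx
  rw [Finset.sum_sub_distrib, Finset.sum_const, Finset.card_univ, Fintype.card_fin,
    nsmul_eq_mul] at hdev
  have hsum : ∑ i, softThreshold ξ (inner ℝ (v n) (x i)) ≤ ∑ i, |inner ℝ (v n) (x i)| :=
    Finset.sum_le_sum fun i _ => softThreshold_le_abs hξ.le _
  refine le_trans ?_ (sum_abs_div_sqrt_le fun i => inner ℝ (v n) (x i))
  rw [le_div_iff₀ hsqrt, sub_mul, div_mul_cancel₀ _ hsqrt.ne']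
  have h1 : ξ * √(m : ℝ) * q * √(m : ℝ) = m * (ξ * q) := by
    linear_combination (ξ * q) * Real.mul_self_sqrt (Nat.cast_nonneg (α := ℝ) m)
  have h2 : (m : ℝ) * (ξ * q) ≤ m * ∫ y, softThreshold ξ (inner ℝ (v n) y) ∂μ :=
    mul_le_mul_of_nonneg_left hmean (Nat.cast_nonneg m)
  linarith

end Deviation

/-! ### Proof of the lower bound -/

lemma continuous_sqrt_sum_inner {d m : ℕ} (x : Fin m → EuclideanSpace ℝ (Fin d)) :
    Continuous fun u : EuclideanSpace ℝ (Fin d) => √(∑ i, |inner ℝ u (x i)| ^ 2) := by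
  fun_prop

lemma supWidth_eq_iSup {Ω : Type*} {d m : ℕ} (X : Fin m → Ω → EuclideanSpace ℝ (Fin d))
    (ε : Fin m → Ω → ℝ) {E : Set (EuclideanSpace ℝ (Fin d))}
    {v : ℕ → EuclideanSpace ℝ (Fin d)} (hv : ∀ n, v n ∈ E) (hE : E ⊆ closure (Set.range v)) :
    supWidth X ε E = fun ω => ⨆ n, (signedInner (v n) (fun i => X i ω) (fun i => ε i ω) : EReal) :=
  funext fun ω => biSup_eq_iSup_seq hv hE (f := fun u => inner ℝ u (signedSum X ε ω))
    (by fun_prop)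

lemma supWidth_of_isEmpty {Ω : Type*} {d : ℕ} (X : Fin 0 → Ω → EuclideanSpace ℝ (Fin d))
    (ε : Fin 0 → Ω → ℝ) {E : Set (EuclideanSpace ℝ (Fin d))} (hE : E.Nonempty) :
    supWidth X ε E = fun _ => 0 := by
  funext ω
  simp only [supWidth, signedSum, Finset.univ_eq_empty, Finset.sum_empty, smul_zero,
    inner_zero_right, EReal.coe_zero]
  exact biSup_const hE

end SmallBall

theorem mainTheorem4 {Ω₀ Ω : Type*} [MeasurableSpace Ω₀] [MeasurableSpace Ω]
    (P₀ : Measure Ω₀) [IsProbabilityMeasure P₀] (P : Measure Ω) [IsProbabilityMeasure P]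
    {m d : ℕ} (E : Set (EuclideanSpace ℝ (Fin d)))
    (φ : Ω₀ → EuclideanSpace ℝ (Fin d))
    (φs : Fin m → Ω → EuclideanSpace ℝ (Fin d)) (ε : Fin m → Ω → ℝ)
    (h_copy : ∀ i, IdentDistrib (φs i) φ P P₀)
    (h_indep : iIndepFun φs P)
    (h_rademacher : ∀ i, SmallBall.IsRademacher P (ε i))
    (h_indep_signs : iIndepFun ε P)
    (h_indep_joint : IndepFun (fun ω i => φs i ω) (fun ω i => ε i ω) P)
    (h_width : SmallBall.ExpectationExists P (SmallBall.supWidth φs ε E))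
    (ξ t : ℝ) (hξ : 0 < ξ) (ht : 0 < t) :
    ENNReal.ofReal (1 - Real.exp (-t ^ 2 / 2)) ≤
      P {ω | ((ξ * √(m : ℝ) : ℝ) : EReal) * (SmallBall.marginalTail P₀ φ E (2 * ξ) : EReal)
              - ((2 : ℝ) : EReal) * SmallBall.meanEmpiricalWidth P φs ε E - ((ξ * t : ℝ) : EReal)
            ≤ SmallBall.infProcess φs E ω} := by
  open SmallBall in
  have hle_one : ENNReal.ofReal (1 - Real.exp (-t ^ 2 / 2)) ≤ 1 := by
    rw [← ENNReal.ofReal_one]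
    exact ENNReal.ofReal_le_ofReal (by linarith [Real.exp_pos (-t ^ 2 / 2)])
  have of_forall : ∀ {p : Ω → Prop}, (∀ ω, p ω) →
      ENNReal.ofReal (1 - Real.exp (-t ^ 2 / 2)) ≤ P {ω | p ω} := fun {p} hp => by
    rw [Set.eq_univ_of_forall (s := {ω | p ω}) hp, measure_univ]
    exact hle_one
  rcases E.eq_empty_or_nonempty with rfl | hE
  · exact of_forall fun ω => by simp [infProcess]
  obtain ⟨v, hv, hvE⟩ := exists_seq_dense hE
  rcases eq_or_ne m 0 with rfl | hm
  -- With no samples the tail term and the width are both 0, leaving -ξ t ≤ 0.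
  · refine of_forall fun ω => ?_
    rw [meanEmpiricalWidth, supWidth_of_isEmpty φs ε hE]
    refine le_biInf_of_seq hvE (continuous_sqrt_sum_inner fun i => φs i ω) fun n => ?_
    simp only [expectation, Nat.cast_zero, Real.sqrt_zero, mul_zero, EReal.coe_zero, zero_mul,
      EReal.toENNReal_zero, neg_zero, lintegral_zero, EReal.coe_ennreal_zero, sub_zero, zero_sub,
      ← EReal.coe_neg, EReal.coe_le_coe_iff]
    exact (neg_nonpos.2 (by positivity)).trans (Real.sqrt_nonneg _)
  have hφ : AEMeasurable φ P₀ := (h_copy ⟨0, Nat.pos_of_ne_zero hm⟩).aemeasurable_snd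
  have hφs : ∀ i, AEMeasurable (φs i) P := fun i => (h_copy i).aemeasurable_fst
  have hprob : IsProbabilityMeasure (P₀.map φ) := Measure.isProbabilityMeasure_map hφ
  have hlaw : P.map (fun ω i => φs i ω) = Measure.pi fun _ : Fin m => P₀.map φ := by
    rw [(iIndepFun_iff_map_fun_eq_pi_map hφs).1 h_indep]
    exact congrArg _ (funext fun i => (h_copy i).map_eq)
  rw [supWidth_eq_iSup φs ε hv hvE] at h_width
  rw [meanEmpiricalWidth, supWidth_eq_iSup φs ε hv hvE]
  rcases expectation_iSup_signedInner hφs hlaw h_rademacher h_indep_signs h_indep_joint v h_width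
    with hW | ⟨hb, hi, hW⟩
  -- Infinite width makes the lower bound ⊥.
  · refine of_forall fun ω => ?_
    rw [hW, EReal.coe_mul_top_of_pos two_pos, EReal.sub_top, EReal.bot_sub]
    exact bot_le
  rw [hW]
  set w : ℝ := (2 ^ m)⁻¹ * ∑ s : Fin m → Bool,
    ∫ x, ⨆ n, signedInner (v n) x (fun i => boolSign (s i)) ∂(Measure.pi fun _ => P₀.map φ)
  have hQle : ∀ n, marginalTail P₀ φ E (2 * ξ) ≤
      (P₀.map φ) {y | 2 * ξ ≤ |inner ℝ (v n) y|} := fun n => by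
    have hA : MeasurableSet {y : EuclideanSpace ℝ (Fin d) | 2 * ξ ≤ |inner ℝ (v n) y|} :=
      measurableSet_le measurable_const (by fun_prop)
    rw [Measure.map_apply_of_aemeasurable hφ hA]
    exact iInf₂_le (v n) (hv n)
  have hQ : marginalTail P₀ φ E (2 * ξ) ≠ ∞ := ne_top_of_le_ne_top (measure_ne_top _ _) (hQle 0)
  set q : ℝ := (marginalTail P₀ φ E (2 * ξ)).toReal
  have hq : ∀ n, q ≤ (P₀.map φ).real {y | 2 * ξ ≤ |inner ℝ (v n) y|} := fun n =>
    ENNReal.toReal_mono (measure_ne_top _ _) (hQle n)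
  have hQq : (marginalTail P₀ φ E (2 * ξ) : EReal) = (q : EReal) := by
    rw [← ENNReal.ofReal_toReal hQ, EReal.coe_ennreal_ofReal, max_eq_left ENNReal.toReal_nonneg]
  have hconc := measure_le_of_bounded_differences (P₀.map φ) hξ hm
    (supDeviation (P₀.map φ) v ξ) (measurable_supDeviation _ v ξ)
    (fun x => abs_iSup_le (abs_sum_deviation_le _ v hξ.le x))
    (abs_supDeviation_update_sub_le _ v hξ.le) ht
  refine hconc.trans ?_
  -- The concentration event is pulled back to Ω. Only its inclusion in the target event is needed,
  -- so the latter need not be measurable.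
  rw [← hlaw, Measure.map_apply_of_aemeasurable (aemeasurable_pi_lambda _ hφs)
    (measurableSet_le (measurable_supDeviation _ v ξ) measurable_const), hlaw]
  refine measure_mono fun ω hω => ?_
  refine le_biInf_of_seq hvE (continuous_sqrt_sum_inner fun i => φs i ω) fun n => ?_
  rw [hQq, ← EReal.coe_mul, ← EReal.coe_mul, ← EReal.coe_sub, ← EReal.coe_sub,
    EReal.coe_le_coe_iff]
  have hmean := integral_supDeviation_le (P₀.map φ) v hξ.le hm hb hi
  have hx := (show supDeviation (P₀.map φ) v ξ (fun i => φs i ω) ≤ _ from hω).trans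
    (add_le_add_left hmean _)
  refine le_trans (le_of_eq ?_) (le_sqrt_of_supDeviation_le (P₀.map φ) v hξ hm hx n (hq n))
  have hsqrt : 0 < √(m : ℝ) := Real.sqrt_pos.2 (by positivity)
  change _ = ξ * √(m : ℝ) * q - (2 * √(m : ℝ) * w + ξ * t * √(m : ℝ)) / √(m : ℝ)
  field_simp
  ring
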